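/- All graphs are finite and undirected, without multiple edges (loops are allowed), and have at least one edge. For a real matrix $S$ with rows and columns indexed by a finite set of $n$ elements and an integer $k\ge 1$, let $C(S,k)=\{MSM^{T} : M\in\mathcal K(k,n)\}$, where $\mathcal K(k,n)$ is the set of nonnegative real $k\times n$ matrices with all row sums equal to $n/k$ and all column sums equal to $1$. For a graph $G$ with adjacency matrix $A_G$, let $C_0(G,k)=\|A_G\|_1^{-1}\,C(A_G,k)$, where $\|\cdot\|_1$ is the sum of the absolute values of the entries. For a finite Borel measure $\mu$ on $[0,1]^2$, let $C(\mu,k)$ be the closure in $\mathbb R^{k\times k}$ of the set of all matrices $\left(\int_{[0,1]^2} f_i(x)f_j(y)\,d\mu(x,y)\right)_{i,j=1}^k$, where $f_1,\dots,f_k$ range over the families of nonnegative Borel functions on $[0,1]$ with $\sum_{i} f_i= 1$ pointwise and $\int_0^1 f_i\,d\lambda=1/k$ for each $i$ ($\lambda$ is Lebesgue measure). The measure $\mu$ is symmetric if it is invariant under $(x,y)\mapsto(y,x)$. Convergence of sets of $k\times k$ matrices is convergence in the Hausdorff distance induced by the $\ell_1$ norm. A sequence $(G_i)$ of graphs is s-convergent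 if for every $k\ge 1$ the sets $C_0(G_i,k)$ converge to some closed set. A sequence $(S_i)$ of nonnegative real square matrices (of possibly different sizes), with $\gamma(S_i)$ denoting the sum of the entries of $S_i$, is convergent if there is a constant $c>0$ such that $\gamma(S_i)<c$ for all $i$ and for every $k\ge 1$ the sets $C(S_i,k)$ converge to some closed subset of $[0,c]^{k\times k}$. **Theorem.** (1) If $(G_i)_{i\ge 1}$ is an s-convergent sequence of graphs, then there is a symmetric Borel probability measure $\mu$ on $[0,1]^2$ (an s-graphon) such that for every integer $k\ge1$, $\lim_{i\to\infty} C_0(G_i,k)=C(\mu,k)$. (2) If $(S_i)_{i\ge 1}$ is a convergent sequence of nonnegative symmetric real matrices, then there is a finite symmetric Borel measure $\mu$ on $[0,1]^2$ such that for every integer $k\ge1$, $\lim_{i\to\infty} C(S_i,k)=C(\mu,k)$. -/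

import Mathlib

open scoped unitInterval

noncomputable section

namespace ShapeLimit

/-- A graph on the vertex set `V`, without multiple edges, in which loop edges are allowed. -/
structure LoopGraph (V : Type*) where
  Adj : V → V → Prop
  symm : ∀ x y, Adj x y → Adj y x

open Classical in
/-- The adjacency matrix `A_G`. -/
def LoopGraph.adjMatrix {V : Type*} (G : LoopGraph V) : Matrix V V ℝ :=
  fun x y => if G.Adj x y then 1 else 0

/-- `γ(S)`, the sum of the entries of `S`. -/
def entrySum {V : Type*} [Fintype V] (S : Matrix V V ℝ) : ℝ := ∑ x, ∑ y, S x y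

/-- `‖S‖₁`, the sum of the absolute values of the entries of `S`. -/
def l1Norm {V : Type*} [Fintype V] (S : Matrix V V ℝ) : ℝ := ∑ x, ∑ y, |S x y|

/-- `𝒦(k, n)`: nonnegative `k × n` matrices with all row sums `n / k` and all column sums `1`;
the columns are indexed by a finite set `V` with `n` elements. -/
def balancedMatrices (k : ℕ) (V : Type*) [Fintype V] : Set (Matrix (Fin k) V ℝ) :=
  {M | (∀ i x, 0 ≤ M i x) ∧ (∀ i, ∑ x, M i x = (Fintype.card V : ℝ) / k) ∧
    ∀ x, ∑ i, M i x = 1}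

/-- The `k`-shape `C(S, k) = {M S Mᵀ | M ∈ 𝒦(k, n)}` of a square matrix `S`. -/
def matrixShape {V : Type*} [Fintype V] (S : Matrix V V ℝ) (k : ℕ) :
    Set (Matrix (Fin k) (Fin k) ℝ) :=
  (fun M : Matrix (Fin k) V ℝ => M * S * M.transpose) '' balancedMatrices k V

/-- The edge-normalized `k`-shape `C₀(G, k) = ‖A_G‖₁⁻¹ C(A_G, k)` of a graph. -/
def graphShape {V : Type*} [Fintype V] (G : LoopGraph V) (k : ℕ) :
    Set (Matrix (Fin k) (Fin k) ℝ) :=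
  (fun X => (l1Norm G.adjMatrix)⁻¹ • X) '' matrixShape G.adjMatrix k

/-- Nonnegative Borel functions `f₁, …, f_k` on `[0,1]` with pointwise sum `1`, each having
Lebesgue integral `1 / k`. -/
def IsBalancedFamily {k : ℕ} (f : Fin k → I → ℝ) : Prop :=
  (∀ i, Measurable (f i)) ∧ (∀ i x, 0 ≤ f i x) ∧ (∀ x, ∑ i, f i x = 1) ∧
    ∀ i, ∫ x, f i x = 1 / (k : ℝ)

/-- The matrix `ℳ(f₁, …, f_k)` with entries `∫ f_i(x) f_j(y) dμ(x, y)`. -/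
def familyMatrix (μ : MeasureTheory.Measure (I × I)) {k : ℕ} (f : Fin k → I → ℝ) :
    Matrix (Fin k) (Fin k) ℝ :=
  fun i j => ∫ p, f i p.1 * f j p.2 ∂μ

/-- `C₀(μ, k)`. -/
def measureShapeZero (μ : MeasureTheory.Measure (I × I)) (k : ℕ) :
    Set (Matrix (Fin k) (Fin k) ℝ) :=
  {X | ∃ f : Fin k → I → ℝ, IsBalancedFamily f ∧ familyMatrix μ f = X}

/-- `C(μ, k)`, the closure of `C₀(μ, k)`. -/
def measureShape (μ : MeasureTheory.Measure (I × I)) (k : ℕ) :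
    Set (Matrix (Fin k) (Fin k) ℝ) :=
  closure (measureShapeZero μ k)

/-- A measure on the unit square is symmetric if it is invariant under `(x, y) ↦ (y, x)`. -/
def IsSymmetricMeasure (μ : MeasureTheory.Measure (I × I)) : Prop := μ.map Prod.swap = μ

/-- An s-graphon: a symmetric Borel probability measure on `[0,1]²`. -/
def IsSGraphon (μ : MeasureTheory.Measure (I × I)) : Prop :=
  MeasureTheory.IsProbabilityMeasure μ ∧ IsSymmetricMeasure μ

/-- A `k × k` matrix as a point of the space `ℝ^{k × k}` with its `ℓ¹` norm. -/
def toL1 {k : ℕ} (X : Matrix (Fin k) (Fin k) ℝ) : PiLp 1 (fun _ : Fin k × Fin k => ℝ) :=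
  WithLp.toLp 1 fun p => X p.1 p.2

/-- The sets `A i` converge to the set `L` in the Hausdorff distance that the `ℓ¹` metric
induces. (The extended distance is used: it is infinite between an empty and a nonempty set.) -/
def HausdorffTendsto {k : ℕ} (A : ℕ → Set (Matrix (Fin k) (Fin k) ℝ))
    (L : Set (Matrix (Fin k) (Fin k) ℝ)) : Prop :=
  Filter.Tendsto (fun i => Metric.hausdorffEDist (toL1 '' A i) (toL1 '' L))
    Filter.atTop (nhds 0)

/-- Convergence of a sequence of nonnegative matrices: the entry sums have a common bound `c`,
and for each `k` the `k`-shapes converge to a closed subset of `[0,c]^{k × k}`. -/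
def MatrixSeqConvergent {V : ℕ → Type*} [∀ i, Fintype (V i)]
    (S : ∀ i, Matrix (V i) (V i) ℝ) : Prop :=
  ∃ c : ℝ, 0 < c ∧ (∀ i, entrySum (S i) < c) ∧
    ∀ k : ℕ, 1 ≤ k → ∃ L : Set (Matrix (Fin k) (Fin k) ℝ),
      IsClosed L ∧ (∀ X ∈ L, ∀ a b, X a b ∈ Set.Icc 0 c) ∧
        HausdorffTendsto (fun i => matrixShape (S i) k) L

/-- s-convergence of a sequence of graphs: for each `k` the edge-normalized `k`-shapes converge
to a closed set. -/
def SConvergent {V : ℕ → Type*} [∀ i, Fintype (V i)] (G : ∀ i, LoopGraph (V i)) : Prop :=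
  ∀ k : ℕ, 1 ≤ k → ∃ L : Set (Matrix (Fin k) (Fin k) ℝ),
    IsClosed L ∧ HausdorffTendsto (fun i => graphShape (G i) k) L

end ShapeLimit

end

/-!
The limit measure is a weak limit of labelled copies of the matrices. Let `L k` be the limit of
the `k`-shapes of the (normalized) matrices `S i`. For every `k` pick a countable dense subset of
`L k`, and realize each of its points as a limit of matrices `M (S i) Mᵀ` with balanced `M`. For
each `i`, the columns of these countably many `M` label every vertex `x` of `S i` by a point
`q i x` of a compact metrizable product of simplices; an independent uniform coordinate in `[0,1]` is
added to the label. The uniform measure on the vertices and the entries of `S i` become measures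
`vertexMeasure` and `edgeMeasure` on the compact label space `P` and on `P × P`, and by
compactness they have weak limits `lam` and `ν` along an ultrafilter. The added coordinate makes
`lam` atomless.

The coordinate functions of `P` are balanced partitions of unity whose matrices are the chosen
points of `L k`, so the shapes of `(lam, ν)` are dense in `L k`. Conversely, a measurable balanced
partition on `P` is `L¹`-close, for `lam` and for the marginals of `ν`, to a continuous partition;
averaged over the fibres of the labelling this gives nearly balanced fractional partitions of the
vertices, and these can be balanced by a uniformly small change. A uniform rather than an `L¹`
bound on that change is essential, as a few vertices may carry most of the mass of `S i`. Hence no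
matrix outside `L k` arises (`eventually_exists_matrixShape_near`).

It remains to move `(lam, ν)` to the unit square with Lebesgue measure. The marginal of `ν` may be
singular to `lam`, so an isomorphism modulo `lam`-null sets is not enough.
`exists_map_eq_volume_injOn` gives a Borel map to `[0,1]` that carries `lam` to Lebesgue measure
and is injective off a set that is null for `lam` and for the marginal of `ν`; the image of `ν`
then has the same matrices (`exists_measure_familyMatrix`).
-/

open scoped unitInterval

noncomputable section

namespace ShapeLimit

open MeasureTheory Filter Topology

/-! ### A measure-preserving map to the interval that is injective off a null set -/

lemma cantorFunction_mem_Icc (f : ℕ → Bool) :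
    Cardinal.cantorFunction (1 / 3) f ∈ Set.Icc (0 : ℝ) (3 / 2) := by
  constructor
  · exact tsum_nonneg fun n => Cardinal.cantorFunctionAux_nonneg (by norm_num)
  · refine (Cardinal.cantorFunction_le (g := fun _ => true) (by norm_num) (by norm_num)
      (by simp)).trans ?_
    have : Cardinal.cantorFunction (1 / 3) (fun _ => true) = ∑' n : ℕ, (1 / 3 : ℝ) ^ n := by
      simp [Cardinal.cantorFunction]
    rw [this, tsum_geometric_of_lt_one (by norm_num) (by norm_num)]
    norm_num

open scoped Pointwise in
/-- The values of the Cantor function series form a Lebesgue null set: the set is covered by two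
copies of itself scaled by `1 / 3`. -/
lemma volume_range_cantorFunction :
    volume (Set.range (Cardinal.cantorFunction (1 / 3))) = 0 := by
  set R := Set.range (Cardinal.cantorFunction (1 / 3)) with hR
  have hsub : R ⊆ ((1 / 3 : ℝ) • R) ∪ ((1 : ℝ) +ᵥ ((1 / 3 : ℝ) • R)) := by
    rintro _ ⟨f, rfl⟩
    rw [Cardinal.cantorFunction_succ f (by norm_num) (by norm_num)]
    have hm : (1 / 3 : ℝ) * Cardinal.cantorFunction (1 / 3) (fun n => f (n + 1)) ∈
        (1 / 3 : ℝ) • R := Set.smul_mem_smul_set ⟨_, rfl⟩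
    cases f 0
    · left; simpa using hm
    · right; exact ⟨_, hm, rfl⟩
  have hfin : volume R ≠ ⊤ := by
    have : R ⊆ Set.Icc 0 (3 / 2) := by
      rintro _ ⟨f, rfl⟩
      exact cantorFunction_mem_Icc f
    exact ((measure_mono this).trans_lt (by simp)).ne
  have hle : volume R ≤ ENNReal.ofReal (2 / 3) * volume R := by
    refine (measure_mono hsub).trans ((measure_union_le _ _).trans ?_)
    rw [measure_vadd, Measure.addHaar_smul, ← add_mul, ← ENNReal.ofReal_add (by positivity)
      (by positivity)]
    norm_num
  have hle' : (volume R).toReal ≤ 2 / 3 * (volume R).toReal := by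
    have := ENNReal.toReal_mono (ENNReal.mul_ne_top ENNReal.ofReal_ne_top hfin) hle
    rwa [ENNReal.toReal_mul, ENNReal.toReal_ofReal (by norm_num)] at this
  have h0 : (volume R).toReal = 0 := le_antisymm (by linarith) ENNReal.toReal_nonneg
  simpa [ENNReal.toReal_eq_zero_iff, hfin] using h0

/-- There is a Borel injection of the Cantor space into a Lebesgue null subset of `[0,1]`. -/
lemma exists_injective_null_range :
    ∃ c : (ℕ → Bool) → I, Measurable c ∧ Function.Injective c ∧
      ∃ Z : Set I, MeasurableSet Z ∧ Set.range c ⊆ Z ∧ volume Z = 0 := by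
  have hcont : Continuous (Cardinal.cantorFunction (1 / 3)) := by
    refine continuous_tsum (u := fun n : ℕ => (1 / 3 : ℝ) ^ n) (fun n => ?_)
      (summable_geometric_of_lt_one (by norm_num) (by norm_num)) fun n f => ?_
    · exact (continuous_of_discreteTopology
        (f := fun b : Bool => cond b ((1 / 3 : ℝ) ^ n) 0)).comp (continuous_apply n)
    · rw [Real.norm_of_nonneg (Cardinal.cantorFunctionAux_nonneg (by norm_num))]
      cases h : f n <;> simp [h]
  obtain ⟨Z, hRZ, hZ, hZ0⟩ := exists_measurable_superset_of_null volume_range_cantorFunction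
  have h01 : ∀ f, Cardinal.cantorFunction (1 / 3) f / 2 ∈ I := by
    intro f
    obtain ⟨h0, h1⟩ := cantorFunction_mem_Icc f
    constructor <;> linarith
  refine ⟨fun f => ⟨_, h01 f⟩, ?_, ?_, (fun x : I => 2 * (x : ℝ)) ⁻¹' Z, ?_, ?_, ?_⟩
  · exact ((hcont.div_const 2).subtype_mk _).measurable
  · intro f g hfg
    refine Cardinal.cantorFunction_injective (c := 1 / 3) (by norm_num) (by norm_num) ?_
    have := congrArg Subtype.val hfg
    simp only at this
    linarith
  · exact (by fun_prop : Measurable (fun x : I => 2 * (x : ℝ))) hZ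
  · rintro _ ⟨f, rfl⟩
    refine hRZ ⟨f, ?_⟩
    simp only
    ring
  · have h0 : volume ((fun x : ℝ => 2 * x) ⁻¹' Z) = 0 := by
      rw [Real.volume_preimage_mul_left (by norm_num), hZ0, mul_zero]
    refine measure_mono_null (t := Subtype.val ⁻¹' ((fun x : ℝ => 2 * x) ⁻¹' Z)) (fun _ h => h) ?_
    have hm : MeasurableSet ((fun x : ℝ => 2 * x) ⁻¹' Z) := measurable_const_mul 2 hZ
    rw [unitInterval.measurePreserving_coe.measure_preimage hm.nullMeasurableSet]
    exact measure_mono_null (Set.Subset.refl _) (Measure.absolutelyContinuous_of_le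
      Measure.restrict_le_self h0)

/-- The probability integral transform: an atomless law on `ℝ` is carried to Lebesgue measure
by its distribution function. -/
lemma map_cdf_eq_volume (ρ : Measure ℝ) [IsProbabilityMeasure ρ] (h : ∀ x, ρ {x} = 0) :
    ρ.map (fun x => (⟨ProbabilityTheory.cdf ρ x, ProbabilityTheory.cdf_nonneg ρ x,
      ProbabilityTheory.cdf_le_one ρ x⟩ : I)) = volume := by
  have hmono := ProbabilityTheory.monotone_cdf ρ
  have hcont : Continuous (ProbabilityTheory.cdf ρ) := by
    refine continuous_iff_continuousAt.2 fun x => ?_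
    rw [hmono.continuousAt_iff_leftLim_eq_rightLim, StieltjesFunction.rightLim_eq]
    have := h x
    rw [← ProbabilityTheory.measure_cdf ρ, StieltjesFunction.measure_singleton,
      ENNReal.ofReal_eq_zero] at this
    exact le_antisymm (hmono.leftLim_le le_rfl) (by linarith)
  have hsurj : ∀ u : ℝ, 0 < u → u < 1 → ∃ t, ProbabilityTheory.cdf ρ t = u := fun u h0 h1 =>
    mem_range_of_exists_le_of_exists_ge hcont
      (((ProbabilityTheory.tendsto_cdf_atBot ρ).eventually_lt_const h0).exists.imp
        fun _ h => h.le)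
      (((ProbabilityTheory.tendsto_cdf_atTop ρ).eventually_const_lt h1).exists.imp
        fun _ h => h.le)
  set F : ℝ → I := fun x => (⟨ProbabilityTheory.cdf ρ x, ProbabilityTheory.cdf_nonneg ρ x,
      ProbabilityTheory.cdf_le_one ρ x⟩ : I) with hF
  have hFmono : Monotone F := fun x y hxy => hmono hxy
  have hFm : Measurable F := hFmono.measurable
  have := Measure.isProbabilityMeasure_map (μ := ρ) hFm.aemeasurable
  refine Measure.ext_of_Iic _ _ fun u => ?_
  rw [Measure.map_apply hFm measurableSet_Iic, unitInterval.volume_Iic]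
  refine le_antisymm ?_ ?_
  · rcases eq_or_lt_of_le u.2.2 with h1 | h1
    · rw [h1]; simpa using prob_le_one
    · refine le_of_forall_gt_imp_ge_of_dense fun a ha => ?_
      rcases le_or_gt 1 a with ha1 | ha1
      · exact prob_le_one.trans ha1
      · have hat : a ≠ ⊤ := (ha1.trans ENNReal.one_lt_top).ne
        have ha2 : (u : ℝ) < a.toReal := (ENNReal.ofReal_lt_iff_lt_toReal u.2.1 hat).1 ha
        obtain ⟨t, ht⟩ := hsurj a.toReal (u.2.1.trans_lt ha2)
          (by simpa using (ENNReal.toReal_lt_toReal hat ENNReal.one_ne_top).2 ha1)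
        refine (measure_mono (t := Set.Iic t) fun x hx => ?_).trans ?_
        · by_contra hxt
          have h1 : ProbabilityTheory.cdf ρ t ≤ ProbabilityTheory.cdf ρ x :=
            hmono (not_le.1 hxt).le
          have h2 : ProbabilityTheory.cdf ρ x ≤ u := hx
          linarith
        · rw [← ProbabilityTheory.ofReal_cdf, ht, ENNReal.ofReal_toReal hat]
  · rcases eq_or_lt_of_le u.2.1 with h0 | h0
    · rw [← h0]; simp
    rcases eq_or_lt_of_le u.2.2 with h1 | h1
    · have : F ⁻¹' Set.Iic u = Set.univ := 
        Set.eq_univ_of_forall fun x => show (F x : ℝ) ≤ u from h1 ▸ (F x).2.2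
      rw [this, h1]; simp
    · obtain ⟨t, ht⟩ := hsurj u h0 h1
      refine le_trans ?_ (measure_mono (s := Set.Iic t) fun x hx => ?_)
      · rw [← ProbabilityTheory.ofReal_cdf, ht]
      · exact (hmono hx).trans ht.le

/-- Let `P` carry an atomless Borel probability measure and a further finite measure `τ`, possibly
singular to it. Then some Borel map carries the probability measure to Lebesgue measure and is
injective off a set that is null for both measures. Off a `lam`-null set supporting the
singular part of `τ`, the map is a distribution function; that set itself is mapped into a
Lebesgue null set. -/
lemma exists_map_eq_volume_injOn {P : Type*} [MeasurableSpace P] [StandardBorelSpace P]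
    (lam τ : Measure P) [IsProbabilityMeasure lam] [IsFiniteMeasure τ] (h : ∀ p, lam {p} = 0) :
    ∃ ψ : P → I, Measurable ψ ∧ lam.map ψ = volume ∧
      ∃ D : Set P, MeasurableSet D ∧ lam D = 0 ∧ τ D = 0 ∧ Set.InjOn ψ Dᶜ := by
  classical
  obtain ⟨e, he⟩ := exists_measurableEmbedding_real P
  obtain ⟨b, hb, hbinj⟩ := MeasurableSpace.measurable_injection_nat_bool_of_countablySeparated P
  obtain ⟨c, hc, hcinj, Z, hZ, hcZ, hZ0⟩ := exists_injective_null_range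
  have : IsProbabilityMeasure (lam.map e) :=
    Measure.isProbabilityMeasure_map he.measurable.aemeasurable
  have hat : ∀ x, (lam.map e) {x} = 0 := by
    intro x
    rw [he.map_apply]
    by_cases hx : ∃ p, e p = x
    · obtain ⟨p, rfl⟩ := hx
      have : e ⁻¹' {e p} = {p} := by
        ext q; simpa using he.injective.eq_iff
      rw [this, h]
    · have : e ⁻¹' {x} = ∅ := by
        ext q
        simp only [Set.mem_preimage, Set.mem_singleton_iff, Set.mem_empty_iff_false, iff_false]
        exact fun hq => hx ⟨q, hq⟩
      simp [this]
  set F : ℝ → I := fun x => (⟨ProbabilityTheory.cdf (lam.map e) x,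
    ProbabilityTheory.cdf_nonneg _ x, ProbabilityTheory.cdf_le_one _ x⟩ : I) with hF
  have hFmono : Monotone F := fun x y hxy => ProbabilityTheory.monotone_cdf _ hxy
  have hFm : Measurable F := hFmono.measurable
  have hFvol : (lam.map e).map F = volume := map_cdf_eq_volume _ hat
  rw [Measure.map_map hFm he.measurable] at hFvol
  have hFe : Measurable (F ∘ e) := hFm.comp he.measurable
  -- `N` has full `lam` measure and is null for the part of `τ` that is singular to `lam`
  obtain ⟨N, hN, hN1, hN2⟩ := Measure.mutuallySingular_singularPart τ lam
  have hτ : ∀ A ⊆ N, lam A = 0 → τ A = 0 := by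
    intro A hA hA0
    rw [τ.haveLebesgueDecomposition_add lam]
    simp only [Measure.coe_add, Pi.add_apply]
    rw [measure_mono_null hA hN1, withDensity_absolutelyContinuous _ _ hA0, add_zero]
  set ψ : P → I := N.piecewise (F ∘ e) (c ∘ b) with hψ
  have hψm : Measurable ψ := Measurable.piecewise hN hFe (hc.comp hb)
  -- `W` contains the image of `Nᶜ` and the values of `F` on its intervals of constancy: every such
  -- interval contains a rational point
  set W : Set I := Z ∪ Set.range (fun r : ℚ => F r) with hW
  have hWm : MeasurableSet W := hZ.union (Set.countable_range _).measurableSet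
  have hW0 : volume W = 0 := measure_union_null hZ0 ((Set.countable_range _).measure_zero _)
  have hlD : lam ((F ∘ e) ⁻¹' W) = 0 := by
    rw [← Measure.map_apply hFe hWm, hFvol, hW0]
  refine ⟨ψ, hψm, ?_, N ∩ (F ∘ e) ⁻¹' W, hN.inter (hFe hWm),
    measure_mono_null Set.inter_subset_right hlD,
    hτ _ Set.inter_subset_left (measure_mono_null Set.inter_subset_right hlD), ?_⟩
  · rw [← hFvol]
    refine Measure.map_congr ?_
    have : ∀ᵐ p ∂lam, p ∈ N := by rw [ae_iff]; exact hN2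
    filter_upwards [this] with p hp
    simp [hψ, hp]
  · have key : ∀ p q, p ∈ N → p ∉ (F ∘ e) ⁻¹' W → q ∈ N → e p < e q → F (e p) ≠ F (e q) := by
      intro p q _ hp _ hlt heq
      obtain ⟨r, hr1, hr2⟩ := exists_rat_btwn hlt
      refine hp (Or.inr ⟨r, le_antisymm ?_ (hFmono hr1.le)⟩)
      exact (hFmono hr2.le).trans heq.ge
    have hcW : ∀ p, c (b p) ∈ W := fun p => Or.inl (hcZ ⟨_, rfl⟩)
    intro p hp q hq hpq
    by_cases hpN : p ∈ N <;> by_cases hqN : q ∈ N <;>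
      simp only [hψ, Set.piecewise, hpN, hqN, if_true, if_false, Function.comp] at hpq
    · have hp' : p ∉ (F ∘ e) ⁻¹' W := fun h => hp ⟨hpN, h⟩
      have hq' : q ∉ (F ∘ e) ⁻¹' W := fun h => hq ⟨hqN, h⟩
      rcases lt_trichotomy (e p) (e q) with hlt | heq | hlt
      · exact absurd hpq (key p q hpN hp' hqN hlt)
      · exact he.injective heq
      · exact absurd hpq.symm (key q p hqN hq' hpN hlt)
    · exact absurd ⟨hpN, by simpa [hpq] using hcW q⟩ hp
    · exact absurd ⟨hqN, by simpa [← hpq] using hcW p⟩ hq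
    · exact hbinj (hcinj hpq)

/-! ### Partitions of unity -/

/-- A finite family of nonnegative functions with pointwise sum `1`. -/
def IsPartition {k : ℕ} {X : Type*} (f : Fin k → X → ℝ) : Prop :=
  (∀ j x, 0 ≤ f j x) ∧ ∀ x, ∑ j, f j x = 1

lemma IsPartition.le_one {k : ℕ} {X : Type*} {f : Fin k → X → ℝ} (hf : IsPartition f)
    (j : Fin k) (x : X) : f j x ≤ 1 := by
  rw [← hf.2 x]
  exact Finset.single_le_sum (fun i _ => hf.1 i x) (Finset.mem_univ j)

lemma IsPartition.abs_le_one {k : ℕ} {X : Type*} {f : Fin k → X → ℝ} (hf : IsPartition f)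
    (j : Fin k) (x : X) : |f j x| ≤ 1 :=
  abs_le.2 ⟨by linarith [hf.1 j x], hf.le_one j x⟩

lemma IsPartition.integrable {k : ℕ} {X : Type*} [MeasurableSpace X] {f : Fin k → X → ℝ}
    (hf : IsPartition f) (hm : ∀ j, Measurable (f j)) (m : Measure X) [IsFiniteMeasure m]
    (j : Fin k) : Integrable (f j) m :=
  Integrable.of_bound (hm j).aestronglyMeasurable 1 (ae_of_all _ (hf.abs_le_one j))

lemma IsPartition.integrable_mul {k : ℕ} {X : Type*} [MeasurableSpace X] {f : Fin k → X → ℝ}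
    (hf : IsPartition f) (hm : ∀ j, Measurable (f j)) (m : Measure (X × X)) [IsFiniteMeasure m]
    (a b : Fin k) : Integrable (fun p : X × X => f a p.1 * f b p.2) m := by
  refine Integrable.of_bound (((hm a).comp measurable_fst).mul
    ((hm b).comp measurable_snd)).aestronglyMeasurable 1 (ae_of_all _ fun p => ?_)
  rw [norm_mul]
  exact mul_le_one₀ (hf.abs_le_one a _) (norm_nonneg _) (hf.abs_le_one b _)

/-- A continuous retraction of `ℝᵏ` onto the standard simplex: positive parts are scaled down
when their sum exceeds `1`, and a constant is added when it falls short. -/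
def simplexRetract {k : ℕ} (u : Fin k → ℝ) (j : Fin k) : ℝ :=
  max (u j) 0 / max (∑ l, max (u l) 0) 1 +
    (1 - (∑ l, max (u l) 0) / max (∑ l, max (u l) 0) 1) / k

lemma simplexRetract_nonneg {k : ℕ} (u : Fin k → ℝ) (j : Fin k) : 0 ≤ simplexRetract u j := by
  have h1 : (1 : ℝ) ≤ max (∑ l, max (u l) 0) 1 := le_max_right _ _
  have h2 : (∑ l, max (u l) 0) / max (∑ l, max (u l) 0) 1 ≤ 1 :=
    div_le_one_of_le₀ (le_max_left _ _) (by linarith)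
  have h3 : 0 ≤ max (u j) 0 := le_max_right _ _
  unfold simplexRetract
  have h4 : 0 ≤ 1 - (∑ l, max (u l) 0) / max (∑ l, max (u l) 0) 1 := by linarith
  positivity

lemma sum_simplexRetract {k : ℕ} (hk : 1 ≤ k) (u : Fin k → ℝ) :
    ∑ j, simplexRetract u j = 1 := by
  unfold simplexRetract
  rw [Finset.sum_add_distrib, ← Finset.sum_div, Finset.sum_const, Finset.card_univ,
    Fintype.card_fin, nsmul_eq_mul]
  have : (k : ℝ) ≠ 0 := by positivity
  field_simp
  ring

lemma continuous_simplexRetract {k : ℕ} (j : Fin k) :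
    Continuous fun u : Fin k → ℝ => simplexRetract u j := by
  have h : ∀ u : Fin k → ℝ, max (∑ l, max (u l) 0) 1 ≠ 0 := fun u =>
    (zero_lt_one.trans_le (le_max_right _ _)).ne'
  unfold simplexRetract
  refine Continuous.add (Continuous.div (by fun_prop) (by fun_prop) h) ?_
  exact (continuous_const.sub (Continuous.div (by fun_prop) (by fun_prop) h)).div_const _

lemma abs_simplexRetract_sub_le {k : ℕ} (hk : 1 ≤ k) (u v : Fin k → ℝ) (hv : ∀ j, 0 ≤ v j)
    (hv1 : ∑ j, v j = 1) (j : Fin k) :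
    |simplexRetract u j - v j| ≤ 3 * ∑ l, |u l - v l| := by
  set δ := ∑ l, |u l - v l| with hδ
  set s := ∑ l, max (u l) 0 with hs
  have hpos : ∀ l, |max (u l) 0 - v l| ≤ |u l - v l| := fun l => by
    have := abs_max_sub_max_le_abs (u l) (v l) 0
    rwa [max_eq_left (hv l)] at this
  have hs1 : |s - 1| ≤ δ := by
    rw [hs, ← hv1, ← Finset.sum_sub_distrib]
    exact (Finset.abs_sum_le_sum_abs _ _).trans (Finset.sum_le_sum fun l _ => hpos l)
  have hj : |max (u j) 0 - v j| ≤ δ := (hpos j).trans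
    (Finset.single_le_sum (f := fun l => |u l - v l|) (fun l _ => abs_nonneg _)
      (Finset.mem_univ j))
  have hjs : max (u j) 0 ≤ s :=
    Finset.single_le_sum (f := fun l => max (u l) 0) (fun l _ => le_max_right _ _)
      (Finset.mem_univ j)
  have hj0 : 0 ≤ max (u j) 0 := le_max_right _ _
  have hδ0 : 0 ≤ δ := Finset.sum_nonneg fun l _ => abs_nonneg _
  set m := max s 1 with hm
  have hm1 : 1 ≤ m := le_max_right _ _
  have hms : s ≤ m := le_max_left _ _
  have hmδ : m ≤ 1 + δ := max_le (by linarith [(abs_le.1 hs1).2]) (by linarith)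
  have hms' : m - s ≤ δ := by
    rw [hm, max_def]
    split_ifs
    · linarith [(abs_le.1 hs1).1]
    · linarith
  have e1 : 0 ≤ max (u j) 0 - max (u j) 0 / m := by
    linarith [div_le_self hj0 hm1]
  have e2 : max (u j) 0 - max (u j) 0 / m ≤ δ := by
    have : max (u j) 0 - max (u j) 0 / m = (max (u j) 0 / m) * (m - 1) := by
      field_simp
    rw [this]
    have h1 : max (u j) 0 / m ≤ 1 := div_le_one_of_le₀ (hjs.trans hms) (by linarith)
    calc _ ≤ 1 * (m - 1) := mul_le_mul_of_nonneg_right h1 (by linarith)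
      _ ≤ δ := by linarith
  have e3 : 0 ≤ (1 - s / m) / k := by
    have := div_le_one_of_le₀ hms (by linarith : 0 ≤ m)
    exact div_nonneg (by linarith) (by positivity)
  have e4 : (1 - s / m) / k ≤ δ := by
    have h1 : s / m ≤ 1 := div_le_one_of_le₀ hms (by linarith)
    have h2 : 1 - s / m = (m - s) / m := by field_simp
    calc (1 - s / m) / k ≤ 1 - s / m := div_le_self (by linarith) (by exact_mod_cast hk)
      _ = (m - s) / m := h2
      _ ≤ m - s := div_le_self (by linarith) hm1
      _ ≤ δ := hms'
  have : simplexRetract u j = max (u j) 0 / m + (1 - s / m) / k := rfl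
  rw [this, abs_le]
  have := abs_le.1 hj
  constructor <;> linarith

/-- Measurable partitions of unity are `L¹`-limits of continuous partitions of unity. -/
lemma exists_continuous_partition {X : Type*} [TopologicalSpace X] [MeasurableSpace X]
    [BorelSpace X] [NormalSpace X] (κ : Measure X) [IsFiniteMeasure κ] [κ.WeaklyRegular] {k : ℕ}
    (hk : 1 ≤ k) (g : Fin k → X → ℝ) (hg : IsPartition g) (hm : ∀ j, Measurable (g j)) {ε : ℝ}
    (hε : 0 < ε) :
    ∃ u : Fin k → X → ℝ, IsPartition u ∧ (∀ j, Continuous (u j)) ∧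
      ∀ j, ∫ x, |u j x - g j x| ∂κ ≤ ε := by
  have hk0 : (0 : ℝ) < k := by exact_mod_cast hk
  have hint := fun j => hg.integrable hm κ j
  choose w hw hwi using fun j =>
    (hint j).exists_boundedContinuous_integral_sub_le (ε := ε / (3 * k)) (by positivity)
  refine ⟨fun j x => simplexRetract (fun l => w l x) j,
    ⟨fun j x => simplexRetract_nonneg _ j, fun x => sum_simplexRetract hk _⟩, fun j => ?_,
    fun j => ?_⟩
  · exact (continuous_simplexRetract j).comp (continuous_pi fun l => (w l).continuous)
  · calc ∫ x, |simplexRetract (fun l => w l x) j - g j x| ∂κ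
        ≤ ∫ x, 3 * ∑ l, |w l x - g l x| ∂κ := by
          refine integral_mono_of_nonneg (ae_of_all _ fun x => abs_nonneg _) ?_
            (ae_of_all _ fun x => abs_simplexRetract_sub_le hk _ _ (fun l => hg.1 l x) (hg.2 x) j)
          exact (integrable_finsetSum _ fun l _ => ((hwi l).sub (hint l)).abs).const_mul 3
      _ = 3 * ∑ l, ∫ x, |w l x - g l x| ∂κ := by
          rw [integral_const_mul]
          exact congrArg _ (integral_finsetSum _ fun l _ => ((hwi l).sub (hint l)).abs)
      _ ≤ 3 * ∑ l : Fin k, ε / (3 * k) := by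
          gcongr with l
          simpa [Real.norm_eq_abs, abs_sub_comm] using hw l
      _ = ε := by
          rw [Finset.sum_const, Finset.card_univ, Fintype.card_fin, nsmul_eq_mul]
          field_simp

/-- The matrix of a partition of unity is Lipschitz in the partition, in the `L¹` norm of the
marginals. -/
lemma abs_integral_mul_sub_le {X : Type*} [MeasurableSpace X] (ν : Measure (X × X))
    [IsFiniteMeasure ν] {k : ℕ} {f g : Fin k → X → ℝ} (hf : IsPartition f) (hg : IsPartition g)
    (hfm : ∀ j, Measurable (f j)) (hgm : ∀ j, Measurable (g j)) (a b : Fin k) :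
    |∫ p, f a p.1 * f b p.2 ∂ν - ∫ p, g a p.1 * g b p.2 ∂ν| ≤
      ∫ x, |f a x - g a x| ∂ν.map Prod.fst + ∫ x, |f b x - g b x| ∂ν.map Prod.snd := by
  have h1 : Integrable (fun p : X × X => |f a p.1 - g a p.1|) ν :=
    (((hf.integrable hfm (ν.map Prod.fst) a).sub
      (hg.integrable hgm (ν.map Prod.fst) a)).abs).comp_measurable measurable_fst
  have h2 : Integrable (fun p : X × X => |f b p.2 - g b p.2|) ν :=
    (((hf.integrable hfm (ν.map Prod.snd) b).sub
      (hg.integrable hgm (ν.map Prod.snd) b)).abs).comp_measurable measurable_snd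
  have e1 : ∫ x, |f a x - g a x| ∂ν.map Prod.fst = ∫ p, |f a p.1 - g a p.1| ∂ν :=
    integral_map measurable_fst.aemeasurable
      ((hfm a).sub (hgm a)).norm.aestronglyMeasurable
  have e2 : ∫ x, |f b x - g b x| ∂ν.map Prod.snd = ∫ p, |f b p.2 - g b p.2| ∂ν :=
    integral_map measurable_snd.aemeasurable
      ((hfm b).sub (hgm b)).norm.aestronglyMeasurable
  rw [e1, e2, ← integral_add h1 h2,
    ← integral_sub (hf.integrable_mul hfm ν a b) (hg.integrable_mul hgm ν a b)]
  refine abs_integral_le_integral_abs.trans (integral_mono_of_nonneg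
    (ae_of_all _ fun p => abs_nonneg _) (h1.add h2) (ae_of_all _ fun p => ?_))
  have e : f a p.1 * f b p.2 - g a p.1 * g b p.2 =
      (f a p.1 - g a p.1) * f b p.2 + g a p.1 * (f b p.2 - g b p.2) := by ring
  simp only [e]
  refine (abs_add_le _ _).trans (add_le_add ?_ ?_)
  · rw [abs_mul]; exact mul_le_of_le_one_right (abs_nonneg _) (hf.abs_le_one b _)
  · rw [abs_mul]; exact mul_le_of_le_one_left (abs_nonneg _) (hg.abs_le_one a _)

/-! ### Balancing a fractional partition of a finite set -/

/-- A fractional partition of a finite set whose row averages are nearly equal is uniformly close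
to a balanced one: shrink it slightly and add constants to the rows. -/
lemma exists_balanced_near {V : Type*} [Fintype V] [Nonempty V] {k : ℕ} (hk : 1 ≤ k)
    (M : Fin k → V → ℝ) (hM : IsPartition M) {δ : ℝ} (hδ1 : k * δ ≤ 1)
    (h : ∀ j, |(∑ x, M j x) / Fintype.card V - 1 / k| ≤ δ) :
    ∃ M' ∈ balancedMatrices k V, ∀ j x, |M' j x - M j x| ≤ 2 * k * δ := by
  have hk1 : (1 : ℝ) ≤ k := by exact_mod_cast hk
  have hk0 : (0 : ℝ) < k := by linarith
  have hn : (0 : ℝ) < Fintype.card V := by exact_mod_cast Fintype.card_pos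
  have hδ : 0 ≤ δ := (abs_nonneg _).trans (h ⟨0, hk⟩)
  set b : Fin k → ℝ := fun j => (∑ x, M j x) / Fintype.card V with hb
  have hbn : ∀ j, ∑ x, M j x = Fintype.card V * b j := fun j => by
    simp only [hb]; field_simp
  have hb0 : ∀ j, 0 ≤ b j := fun j => div_nonneg (Finset.sum_nonneg fun x _ => hM.1 j x) hn.le
  have hbs : ∑ j, b j = 1 := by
    simp only [hb]
    rw [← Finset.sum_div, Finset.sum_comm, Finset.sum_congr rfl fun x _ => hM.2 x]
    simp [hn.ne']
  have hb1 : ∀ j, b j ≤ 1 := fun j => by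
    rw [← hbs]; exact Finset.single_le_sum (fun i _ => hb0 i) (Finset.mem_univ j)
  set s := k * δ with hs
  have hs0 : 0 ≤ s := by positivity
  have hsk : s * (1 / k) = δ := by rw [hs]; field_simp
  have hc : ∀ j, 0 ≤ 1 / k - (1 - s) * b j := fun j => by
    have h1 : b j ≤ 1 / k + δ := by linarith [(abs_le.1 (h j)).2]
    have h2 : (1 - s) * b j ≤ (1 - s) * (1 / k + δ) :=
      mul_le_mul_of_nonneg_left h1 (by linarith)
    nlinarith [mul_nonneg hs0 hδ]
  refine ⟨fun j x => (1 - s) * M j x + (1 / k - (1 - s) * b j), ⟨fun j x => ?_, fun j => ?_,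
    fun x => ?_⟩, fun j x => ?_⟩
  · exact add_nonneg (mul_nonneg (by linarith) (hM.1 j x)) (hc j)
  · rw [Finset.sum_add_distrib, ← Finset.mul_sum, hbn, Finset.sum_const, Finset.card_univ,
      nsmul_eq_mul]
    field_simp
    ring
  · rw [Finset.sum_add_distrib, ← Finset.mul_sum, hM.2 x, Finset.sum_sub_distrib,
      ← Finset.mul_sum, hbs, Finset.sum_const, Finset.card_univ, Fintype.card_fin, nsmul_eq_mul]
    field_simp
    ring
  · have e : (1 - s) * M j x + (1 / k - (1 - s) * b j) - M j x =
        s * (b j - M j x) - (b j - 1 / k) := by ring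
    have h1 : |b j - M j x| ≤ 1 := abs_le.2
      ⟨by linarith [hM.le_one j x, hb0 j], by linarith [hM.1 j x, hb1 j]⟩
    rw [e]
    calc |s * (b j - M j x) - (b j - 1 / k)| ≤ |s * (b j - M j x)| + |b j - 1 / k| := abs_sub _ _
      _ ≤ s * 1 + δ := by
        rw [abs_mul, abs_of_nonneg hs0]
        exact add_le_add (mul_le_mul_of_nonneg_left h1 hs0) (h j)
      _ ≤ 2 * k * δ := by nlinarith

lemma mul_mul_transpose_apply {V : Type*} [Fintype V] {k : ℕ} (M : Matrix (Fin k) V ℝ)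
    (S : Matrix V V ℝ) (a b : Fin k) :
    (M * S * M.transpose) a b = ∑ x, ∑ y, S x y * (M a x * M b y) := by
  simp only [Matrix.mul_apply, Matrix.transpose_apply, Finset.sum_mul]
  rw [Finset.sum_comm]
  exact Finset.sum_congr rfl fun x _ => Finset.sum_congr rfl fun y _ => by ring

lemma abs_mul_mul_transpose_sub_le {V : Type*} [Fintype V] {k : ℕ} {M M' : Matrix (Fin k) V ℝ}
    {S : Matrix V V ℝ} (hS : ∀ x y, 0 ≤ S x y) (hM : IsPartition M) (hM' : IsPartition M')
    {η : ℝ} (h : ∀ j x, |M' j x - M j x| ≤ η) (a b : Fin k) :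
    |(M' * S * M'.transpose) a b - (M * S * M.transpose) a b| ≤ 2 * η * entrySum S := by
  rw [mul_mul_transpose_apply, mul_mul_transpose_apply, entrySum, ← Finset.sum_sub_distrib,
    Finset.mul_sum]
  refine (Finset.abs_sum_le_sum_abs _ _).trans (Finset.sum_le_sum fun x _ => ?_)
  rw [← Finset.sum_sub_distrib, Finset.mul_sum]
  refine (Finset.abs_sum_le_sum_abs _ _).trans (Finset.sum_le_sum fun y _ => ?_)
  have e : S x y * (M' a x * M' b y) - S x y * (M a x * M b y) =
      S x y * ((M' a x - M a x) * M' b y + M a x * (M' b y - M b y)) := by ring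
  rw [e, abs_mul, abs_of_nonneg (hS x y), mul_comm]
  refine mul_le_mul_of_nonneg_right ?_ (hS x y)
  refine (abs_add_le _ _).trans ?_
  rw [abs_mul, abs_mul, two_mul]
  have hη : 0 ≤ η := (abs_nonneg _).trans (h a x)
  exact add_le_add
    ((mul_le_of_le_one_right (abs_nonneg _) (hM'.abs_le_one b y)).trans (h a x))
    ((mul_le_of_le_one_left (abs_nonneg _) (hM.abs_le_one a x)).trans (h b y))

/-! ### Limits of measures along an ultrafilter -/

/-- Finite measures of bounded mass on a compact space converge weakly along any ultrafilter. -/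
lemma exists_tendsto_integral {X : Type*} [TopologicalSpace X] [CompactSpace X] [T2Space X]
    [MeasurableSpace X] [BorelSpace X] (U : Ultrafilter ℕ) (m : ℕ → Measure X)
    [∀ i, IsFiniteMeasure (m i)] {C : ℝ} (hC : ∀ i, (m i).real Set.univ ≤ C) :
    ∃ m' : Measure X, IsFiniteMeasure m' ∧ ∀ g : X → ℝ, Continuous g →
      Tendsto (fun i => ∫ x, g x ∂m i) U (𝓝 (∫ x, g x ∂m')) := by
  have hcomp := isCompact_setOfPred_finiteMeasure_le_of_compactSpace X C.toNNReal
  let μ : ℕ → FiniteMeasure X := fun i => ⟨m i, inferInstance⟩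
  have hmem : ∀ i, μ i ∈ {ν : FiniteMeasure X | ν.mass ≤ C.toNNReal} := fun i =>
    NNReal.coe_le_coe.1 ((hC i).trans (Real.le_coe_toNNReal C))
  obtain ⟨m', -, hm'⟩ := hcomp.ultrafilter_le_nhds (U.map μ) (by
    rw [Ultrafilter.coe_map, le_principal_iff]
    exact mem_map.2 (Eventually.of_forall hmem))
  refine ⟨m', inferInstance, fun g hg => ?_⟩
  have h : Tendsto μ U (𝓝 m') := hm'
  exact FiniteMeasure.tendsto_iff_forall_integral_tendsto.1 h
    (BoundedContinuousFunction.mkOfCompact ⟨g, hg⟩)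

/-! ### The measures of a labelled weighted graph -/

section Label

open scoped ENNReal

variable {Ω : Type*} [MeasurableSpace Ω] {V : Type*} [Fintype V]

/-- The law of `(ω, t)` for `t` uniform in `[0,1]`. -/
def fibreMeasure (ω : Ω) : Measure (Ω × I) := (volume : Measure I).map (Prod.mk ω)

instance (ω : Ω) : IsProbabilityMeasure (fibreMeasure ω) :=
  Measure.isProbabilityMeasure_map measurable_prodMk_left.aemeasurable

/-- The law of `(q x, t)` for a uniform vertex `x` and an independent uniform `t ∈ [0,1]`; the zero
measure if there are no vertices. -/
def vertexMeasure (q : V → Ω) : Measure (Ω × I) :=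
  ∑ x, (Fintype.card V : ℝ≥0∞)⁻¹ • fibreMeasure (q x)

/-- The entry `S x y` is spread as a mass over the pairs `((q x, t), (q y, s))` with `t` and `s`
independent and uniform in `[0,1]`. -/
def edgeMeasure (S : Matrix V V ℝ) (q : V → Ω) : Measure ((Ω × I) × (Ω × I)) :=
  ∑ x, ∑ y, ENNReal.ofReal (S x y) • (fibreMeasure (q x)).prod (fibreMeasure (q y))

lemma integral_fibreMeasure (ω : Ω) {g : Ω × I → ℝ} (hg : Measurable g) :
    ∫ p, g p ∂fibreMeasure ω = ∫ t, g (ω, t) :=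
  integral_map measurable_prodMk_left.aemeasurable hg.aestronglyMeasurable

lemma map_snd_vertexMeasure [Nonempty V] (q : V → Ω) :
    (vertexMeasure q).map Prod.snd = volume := by
  ext s hs
  have h : ∀ x, fibreMeasure (q x) (Prod.snd ⁻¹' s) = volume s := fun x => by
    rw [fibreMeasure, Measure.map_apply measurable_prodMk_left (measurable_snd hs)]
    rfl
  rw [Measure.map_apply measurable_snd hs, vertexMeasure, Measure.finsetSum_apply]
  simp only [Measure.smul_apply, h, smul_eq_mul]
  rw [Finset.sum_const, Finset.card_univ, nsmul_eq_mul, ← mul_assoc,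
    ENNReal.mul_inv_cancel (by simp) (by simp), one_mul]

instance [Nonempty V] (q : V → Ω) : IsProbabilityMeasure (vertexMeasure q) := by
  constructor
  have := congrArg (fun m => m Set.univ) (map_snd_vertexMeasure q)
  simpa [Measure.map_apply measurable_snd MeasurableSet.univ] using this

lemma edgeMeasure_univ (S : Matrix V V ℝ) (hS : ∀ x y, 0 ≤ S x y) (q : V → Ω) :
    edgeMeasure S q Set.univ = ENNReal.ofReal (entrySum S) := by
  rw [edgeMeasure, entrySum,
    ENNReal.ofReal_sum_of_nonneg fun x _ => Finset.sum_nonneg fun y _ => hS x y,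
    Measure.finsetSum_apply]
  refine Finset.sum_congr rfl fun x _ => ?_
  rw [ENNReal.ofReal_sum_of_nonneg fun y _ => hS x y, Measure.finsetSum_apply]
  simp

instance (S : Matrix V V ℝ) (q : V → Ω) : IsFiniteMeasure (edgeMeasure S q) := by
  constructor
  simp only [edgeMeasure, Measure.finsetSum_apply, Measure.smul_apply, measure_univ, smul_eq_mul,
    mul_one]
  exact ENNReal.sum_lt_top.2 fun x _ => ENNReal.sum_lt_top.2 fun y _ => ENNReal.ofReal_lt_top

lemma map_swap_edgeMeasure (S : Matrix V V ℝ) (hS : S.IsSymm) (q : V → Ω) :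
    (edgeMeasure S q).map Prod.swap = edgeMeasure S q := by
  ext s hs
  rw [Measure.map_apply measurable_swap hs]
  simp only [edgeMeasure, Measure.finsetSum_apply, Measure.smul_apply]
  rw [Finset.sum_comm]
  refine Finset.sum_congr rfl fun x _ => Finset.sum_congr rfl fun y _ => ?_
  rw [← Measure.map_apply measurable_swap hs, Measure.prod_swap, hS.apply]

lemma integral_vertexMeasure {k : ℕ} {g : Fin k → Ω × I → ℝ} (hg : IsPartition g)
    (hm : ∀ j, Measurable (g j)) (q : V → Ω) (j : Fin k) :
    ∫ p, g j p ∂vertexMeasure q = (∑ x, ∫ t, g j (q x, t)) / Fintype.card V := by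
  rw [vertexMeasure, integral_finsetSum_measure, Finset.sum_div]
  · refine Finset.sum_congr rfl fun x _ => ?_
    rw [integral_smul_measure, integral_fibreMeasure _ (hm j)]
    simp [div_eq_inv_mul]
  · intro x _
    have : Nonempty V := ⟨x⟩
    exact (hg.integrable hm _ j).smul_measure (by simp)

/-- Averaging a partition of unity over the fibres of the labelling turns its matrix with respect
to the edge measure into `M S Mᵀ`. -/
lemma integral_edgeMeasure {k : ℕ} {g : Fin k → Ω × I → ℝ} (hg : IsPartition g)
    (hm : ∀ j, Measurable (g j)) {S : Matrix V V ℝ} (hS : ∀ x y, 0 ≤ S x y) (q : V → Ω)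
    (a b : Fin k) {M : Matrix (Fin k) V ℝ} (hM : ∀ j x, M j x = ∫ t, g j (q x, t)) :
    ∫ p, g a p.1 * g b p.2 ∂edgeMeasure S q = (M * S * M.transpose) a b := by
  rw [mul_mul_transpose_apply, edgeMeasure, integral_finsetSum_measure]
  · refine Finset.sum_congr rfl fun x _ => ?_
    rw [integral_finsetSum_measure]
    · refine Finset.sum_congr rfl fun y _ => ?_
      rw [integral_smul_measure, integral_prod_mul, integral_fibreMeasure _ (hm a),
        integral_fibreMeasure _ (hm b), hM, hM, ENNReal.toReal_ofReal (hS x y), smul_eq_mul]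
    · exact fun y _ => (hg.integrable_mul hm _ a b).smul_measure ENNReal.ofReal_ne_top
  · exact fun x _ => integrable_finsetSum_measure.2
      fun y _ => (hg.integrable_mul hm _ a b).smul_measure ENNReal.ofReal_ne_top

end Label

lemma IsPartition.integral_fibre {Ω V : Type*} [MeasurableSpace Ω] {k : ℕ}
    {g : Fin k → Ω × I → ℝ} (hg : IsPartition g) (hm : ∀ j, Measurable (g j)) (q : V → Ω) :
    IsPartition fun j x => ∫ t, g j (q x, t) := by
  refine ⟨fun j x => integral_nonneg fun t => hg.1 j _, fun x => ?_⟩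
  have hp : IsPartition fun j (t : I) => g j (q x, t) := ⟨fun j t => hg.1 j _, fun t => hg.2 _⟩
  rw [← integral_finsetSum _ fun j _ =>
    hp.integrable (fun j => (hm j).comp measurable_prodMk_left) volume j]
  simp [hg.2]

/-- Weak limits of the vertex and edge measures have no more shapes than the graphs: the matrix of
a measurable balanced partition of unity on the limit space is approximated by matrices
`M S Mᵀ`. The partition is replaced by a continuous one, which is averaged over the fibres of the
labelling and then balanced. -/
lemma eventually_exists_matrixShape_near {Ω : Type*} [TopologicalSpace Ω] [CompactSpace Ω]
    [T2Space Ω] [SecondCountableTopology Ω] [MeasurableSpace Ω] [BorelSpace Ω]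
    {V : ℕ → Type*} [∀ i, Fintype (V i)] [∀ i, Nonempty (V i)]
    {S : ∀ i, Matrix (V i) (V i) ℝ} (hS : ∀ i x y, 0 ≤ S i x y) {c : ℝ}
    (hc : ∀ i, entrySum (S i) ≤ c) (q : ∀ i, V i → Ω) {l : Filter ℕ} {lam : Measure (Ω × I)}
    [IsFiniteMeasure lam] {ν : Measure ((Ω × I) × (Ω × I))} [IsFiniteMeasure ν]
    (hlam : ∀ g : Ω × I → ℝ, Continuous g →
      Tendsto (fun i => ∫ p, g p ∂vertexMeasure (q i)) l (𝓝 (∫ p, g p ∂lam)))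
    (hν : ∀ g : (Ω × I) × (Ω × I) → ℝ, Continuous g →
      Tendsto (fun i => ∫ p, g p ∂edgeMeasure (S i) (q i)) l (𝓝 (∫ p, g p ∂ν)))
    {k : ℕ} (hk : 1 ≤ k) {g : Fin k → Ω × I → ℝ} (hg : IsPartition g)
    (hgm : ∀ j, Measurable (g j)) (hgl : ∀ j, ∫ p, g j p ∂lam = 1 / k) {ε : ℝ} (hε : 0 < ε) :
    ∀ᶠ i in l, ∃ Z ∈ matrixShape (S i) k,
      ∀ a b, |Z a b - ∫ p, g a p.1 * g b p.2 ∂ν| ≤ ε := by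
  have hk0 : (0 : ℝ) < k := by exact_mod_cast hk
  set c' := max c 0 with hc'
  have hc0 : 0 ≤ c' := le_max_right _ _
  -- the error budget: `2 * δ` for the row averages, hence `8 * k * c' * δ` from the balancing,
  -- `2 * δ` from the continuous approximation, and `δ` from the weak convergence
  obtain ⟨δ, hδ, hδ1, hδ2⟩ : ∃ δ : ℝ, 0 < δ ∧ k * (2 * δ) ≤ 1 ∧ (8 * k * c' + 3) * δ ≤ ε := by
    refine ⟨min (1 / (2 * k)) (ε / (8 * k * c' + 3)), by positivity, ?_, ?_⟩
    · calc k * (2 * min (1 / (2 * (k : ℝ))) (ε / (8 * k * c' + 3)))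
          ≤ k * (2 * (1 / (2 * k))) := by gcongr; exact min_le_left _ _
        _ = 1 := by field_simp
    · calc (8 * k * c' + 3) * min (1 / (2 * (k : ℝ))) (ε / (8 * k * c' + 3))
          ≤ (8 * k * c' + 3) * (ε / (8 * k * c' + 3)) := by gcongr; exact min_le_right _ _
        _ = ε := by field_simp
  have hcomp : ∀ (m m' : Measure (Ω × I)), m ≤ m' → ∀ f : Ω × I → ℝ, Integrable f m' →
      ∫ x, |f x| ∂m ≤ ∫ x, |f x| ∂m' := fun m m' h f hf =>
    integral_mono_measure h (ae_of_all _ fun x => abs_nonneg _) hf.abs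
  let _ := TopologicalSpace.metrizableSpaceMetric (Ω × I)
  obtain ⟨u, hu, huc, hug⟩ := exists_continuous_partition
    (lam + ν.map Prod.fst + ν.map Prod.snd) hk g hg hgm hδ
  have hum : ∀ j, Measurable (u j) := fun j => (huc j).measurable
  have hint : ∀ j, Integrable (fun x => u j x - g j x)
      (lam + ν.map Prod.fst + ν.map Prod.snd) := fun j =>
    (hu.integrable hum _ j).sub (hg.integrable hgm _ j)
  have h1 : ∀ j, |∫ p, u j p ∂lam - 1 / k| ≤ δ := fun j => by
    rw [← hgl j, ← integral_sub (hu.integrable hum _ j) (hg.integrable hgm _ j)]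
    refine abs_integral_le_integral_abs.trans ((hcomp _ _ ?_ _ (hint j)).trans (hug j))
    rw [add_assoc]
    exact Measure.le_add_right le_rfl
  have h2 : ∀ a b, |∫ p, u a p.1 * u b p.2 ∂ν - ∫ p, g a p.1 * g b p.2 ∂ν| ≤ 2 * δ := by
    intro a b
    refine (abs_integral_mul_sub_le ν hu hg hum hgm a b).trans ?_
    rw [two_mul]
    refine add_le_add ((hcomp _ _ ?_ _ (hint a)).trans (hug a))
      ((hcomp _ _ ?_ _ (hint b)).trans (hug b))
    · exact Measure.le_add_right (Measure.le_add_left le_rfl)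
    · exact Measure.le_add_left le_rfl
  have e1 : ∀ᶠ i in l, ∀ j, |∫ p, u j p ∂vertexMeasure (q i) - ∫ p, u j p ∂lam| < δ :=
    eventually_all.2 fun j => Metric.tendsto_nhds.1 (hlam _ (huc j)) δ hδ
  have e2 : ∀ᶠ i in l, ∀ a b, |∫ p, u a p.1 * u b p.2 ∂edgeMeasure (S i) (q i) -
      ∫ p, u a p.1 * u b p.2 ∂ν| < δ :=
    eventually_all.2 fun a => eventually_all.2 fun b => Metric.tendsto_nhds.1
      (hν _ (((huc a).comp continuous_fst).mul ((huc b).comp continuous_snd))) δ hδ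
  filter_upwards [e1, e2] with i hi1 hi2
  have hM := hu.integral_fibre hum (q i)
  obtain ⟨M', hM', hMM'⟩ := exists_balanced_near hk _ hM hδ1 fun j => by
    rw [← integral_vertexMeasure hu hum (q i) j]
    have := abs_sub_le (∫ p, u j p ∂vertexMeasure (q i)) (∫ p, u j p ∂lam) (1 / k)
    linarith [h1 j, hi1 j]
  refine ⟨_, ⟨M', hM', rfl⟩, fun a b => ?_⟩
  have h3 := abs_mul_mul_transpose_sub_le (hS i) hM ⟨hM'.1, hM'.2.2⟩ hMM' a b
  rw [← integral_edgeMeasure hu hum (hS i) (q i) a b fun _ _ => rfl] at h3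
  have h4 := abs_sub_le ((M' * S i * M'.transpose) a b)
    (∫ p, u a p.1 * u b p.2 ∂edgeMeasure (S i) (q i)) (∫ p, g a p.1 * g b p.2 ∂ν)
  have h5 := abs_sub_le (∫ p, u a p.1 * u b p.2 ∂edgeMeasure (S i) (q i))
    (∫ p, u a p.1 * u b p.2 ∂ν) (∫ p, g a p.1 * g b p.2 ∂ν)
  have h6 : 2 * (2 * k * (2 * δ)) * entrySum (S i) ≤ 2 * (2 * k * (2 * δ)) * c' :=
    mul_le_mul_of_nonneg_left ((hc i).trans (le_max_left _ _)) (by positivity)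
  have := h2 a b
  have := (hi2 a b).le
  simp only at *
  nlinarith

/-! ### Hausdorff convergence of sets of matrices -/

lemma isClosed_image_toL1 {k : ℕ} {L : Set (Matrix (Fin k) (Fin k) ℝ)} (hL : IsClosed L) :
    IsClosed (toL1 '' L) := by
  have h : toL1 '' L = (fun v : PiLp 1 (fun _ : Fin k × Fin k => ℝ) =>
      (Matrix.of fun a b => v (a, b) : Matrix (Fin k) (Fin k) ℝ)) ⁻¹' L := by
    ext v
    constructor
    · rintro ⟨X, hX, rfl⟩; exact hX
    · intro hv; exact ⟨_, hv, rfl⟩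
  rw [h]
  exact hL.preimage (continuous_pi fun a => continuous_pi fun b =>
    (PiLp.continuous_apply 1 _ (a, b)))

lemma edist_toL1_le {k : ℕ} {X Y : Matrix (Fin k) (Fin k) ℝ} {ε : ℝ}
    (h : ∀ a b, |X a b - Y a b| ≤ ε) : edist (toL1 X) (toL1 Y) ≤ ENNReal.ofReal (k * k * ε) := by
  rw [edist_dist]
  refine ENNReal.ofReal_le_ofReal ?_
  rw [PiLp.dist_eq_of_L1]
  calc ∑ p, dist ((toL1 X) p) ((toL1 Y) p) ≤ ∑ _p : Fin k × Fin k, ε :=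
        Finset.sum_le_sum fun p _ => h p.1 p.2
    _ = k * k * ε := by simp

lemma HausdorffTendsto.nonempty {k : ℕ} {A : ℕ → Set (Matrix (Fin k) (Fin k) ℝ)}
    {L : Set (Matrix (Fin k) (Fin k) ℝ)} (h : HausdorffTendsto A L) (hA : ∀ i, (A i).Nonempty) :
    L.Nonempty := by
  obtain ⟨i, hi⟩ := (h.eventually_lt_const ENNReal.zero_lt_top).exists
  by_contra hL
  rw [Set.not_nonempty_iff_eq_empty.1 hL, Set.image_empty,
    Metric.hausdorffEDist_empty ((hA i).image _)] at hi
  exact lt_irrefl _ hi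

lemma HausdorffTendsto.exists_tendsto {k : ℕ} {A : ℕ → Set (Matrix (Fin k) (Fin k) ℝ)}
    {L : Set (Matrix (Fin k) (Fin k) ℝ)} (h : HausdorffTendsto A L) (hA : ∀ i, (A i).Nonempty)
    {X : Matrix (Fin k) (Fin k) ℝ} (hX : X ∈ L) :
    ∃ Y : ℕ → Matrix (Fin k) (Fin k) ℝ, (∀ i, Y i ∈ A i) ∧
      ∀ a b, Tendsto (fun i => Y i a b) atTop (𝓝 (X a b)) := by
  have hd : Tendsto (fun i => Metric.infEDist (toL1 X) (toL1 '' A i)) atTop (𝓝 0) := by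
    refine tendsto_of_tendsto_of_tendsto_of_le_of_le tendsto_const_nhds h (fun i => zero_le)
      fun i => ?_
    rw [Metric.hausdorffEDist_comm]
    exact Metric.infEDist_le_hausdorffEDist_of_mem ⟨X, hX, rfl⟩
  have hY : ∀ i : ℕ, ∃ Y ∈ A i, edist (toL1 X) (toL1 Y) ≤
      Metric.infEDist (toL1 X) (toL1 '' A i) + (i : ENNReal)⁻¹ := by
    intro i
    by_cases hi : Metric.infEDist (toL1 X) (toL1 '' A i) = ⊤
    · obtain ⟨Y, hY⟩ := hA i
      exact ⟨Y, hY, by simp [hi]⟩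
    · have hlt := ENNReal.lt_add_right hi (ENNReal.inv_ne_zero.2 (ENNReal.natCast_ne_top i))
      obtain ⟨_, ⟨Y, hY, rfl⟩, hlt'⟩ := Metric.infEDist_lt_iff.1 hlt
      exact ⟨Y, hY, hlt'.le⟩
  choose Y hYA hYd using hY
  refine ⟨Y, hYA, fun a b => ?_⟩
  have hlim : Tendsto (fun i => toL1 (Y i)) atTop (𝓝 (toL1 X)) := by
    rw [tendsto_iff_edist_tendsto_0]
    refine tendsto_of_tendsto_of_tendsto_of_le_of_le tendsto_const_nhds
      (by simpa using hd.add ENNReal.tendsto_inv_nat_nhds_zero) (fun i => zero_le) fun i => ?_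
    rw [edist_comm]
    exact hYd i
  exact ((PiLp.continuous_apply 1 (fun _ : Fin k × Fin k => ℝ) (a, b)).tendsto _).comp hlim

/-- A point that is approximated by the sets along some finer filter lies in the closed limit. -/
lemma HausdorffTendsto.mem_of_eventually_near {k : ℕ} {A : ℕ → Set (Matrix (Fin k) (Fin k) ℝ)}
    {L : Set (Matrix (Fin k) (Fin k) ℝ)} (h : HausdorffTendsto A L) (hL : IsClosed L)
    {l : Filter ℕ} [l.NeBot] (hl : l ≤ atTop) {Y : Matrix (Fin k) (Fin k) ℝ}
    (hY : ∀ ε : ℝ, 0 < ε → ∀ᶠ i in l, ∃ Z ∈ A i, ∀ a b, |Z a b - Y a b| ≤ ε) : Y ∈ L := by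
  suffices hmem : toL1 Y ∈ toL1 '' L by
    obtain ⟨X, hX, hXY⟩ := hmem
    have : X = Y := by
      ext a b
      exact congrArg (fun v : PiLp 1 (fun _ : Fin k × Fin k => ℝ) => v (a, b)) hXY
    exact this ▸ hX
  have hclosed := isClosed_image_toL1 hL
  rw [← hclosed.closure_eq, Metric.mem_closure_iff_infEDist_zero]
  refine nonpos_iff_eq_zero.1 (ENNReal.le_of_forall_pos_le_add fun ε hε _ => ?_)
  have hε' : (0 : ℝ) < ε / 2 := by positivity
  have h1 := hY (ε / 2 / (k * k + 1)) (by positivity)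
  have h2 : ∀ᶠ i in l, Metric.hausdorffEDist (toL1 '' A i) (toL1 '' L) <
      ENNReal.ofReal (ε / 2) :=
    hl (h.eventually_lt_const (ENNReal.ofReal_pos.2 hε'))
  obtain ⟨i, ⟨Z, hZ, hZY⟩, hi⟩ := (h1.and h2).exists
  have h3 : edist (toL1 Y) (toL1 Z) ≤ ENNReal.ofReal (ε / 2) := by
    rw [edist_comm]
    refine (edist_toL1_le hZY).trans (ENNReal.ofReal_le_ofReal ?_)
    rw [mul_div_left_comm]
    refine mul_le_of_le_one_right hε'.le (div_le_one_of_le₀ ?_ ?_) <;> nlinarith [sq_nonneg (k : ℝ)]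
  calc Metric.infEDist (toL1 Y) (toL1 '' L)
      ≤ edist (toL1 Y) (toL1 Z) + Metric.infEDist (toL1 Z) (toL1 '' L) :=
        Metric.infEDist_le_edist_add_infEDist
    _ ≤ ENNReal.ofReal (ε / 2) + ENNReal.ofReal (ε / 2) :=
        add_le_add h3 ((Metric.infEDist_le_hausdorffEDist_of_mem
          (Set.mem_image_of_mem toL1 hZ)).trans hi.le)
    _ = 0 + ε := by
        rw [← ENNReal.ofReal_add hε'.le hε'.le, add_halves, zero_add, ENNReal.ofReal_coe_nnreal]

/-! ### Transfer of partitions of unity to the interval -/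

/-- Along a Borel map that is injective off `D`, every measurable partition of unity is, off `D`,
the pullback of a measurable partition of unity. -/
lemma exists_partition_extend {P : Type*} [MeasurableSpace P] [StandardBorelSpace P] {ψ : P → I}
    (hψ : Measurable ψ) {D : Set P} (hD : MeasurableSet D) (hinj : Set.InjOn ψ Dᶜ) {k : ℕ}
    (hk : 1 ≤ k) {g : Fin k → P → ℝ} (hg : IsPartition g) (hgm : ∀ j, Measurable (g j)) :
    ∃ h : Fin k → I → ℝ, IsPartition h ∧ (∀ j, Measurable (h j)) ∧
      ∀ p ∉ D, ∀ j, h j (ψ p) = g j p := by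
  have : Nonempty (Fin k) := ⟨⟨0, hk⟩⟩
  have := hD.compl.standardBorel
  have hemb : MeasurableEmbedding fun p : (Dᶜ : Set P) => ψ p :=
    (hψ.comp measurable_subtype_coe).measurableEmbedding (Set.injOn_iff_injective.1 hinj)
  obtain ⟨h, hm, hh⟩ := hemb.exists_measurable_extend
    (g := fun p : (Dᶜ : Set P) => (⟨fun j => g j p, fun j => hg.1 j p, hg.2 p⟩ :
      stdSimplex ℝ (Fin k)))
    (Measurable.subtype_mk (measurable_pi_lambda _ fun j => (hgm j).comp measurable_subtype_coe))
    (fun _ => inferInstance)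
  refine ⟨fun j t => (h t).1 j, ⟨fun j t => (h t).2.1 j, fun t => (h t).2.2⟩, fun j =>
    (measurable_pi_apply j).comp (measurable_subtype_coe.comp hm), fun p hp j => ?_⟩
  have := congrFun hh ⟨p, hp⟩
  exact congrArg (fun v : stdSimplex ℝ (Fin k) => v.1 j) this

/-- A finite symmetric measure `ν` over an atomless probability space has a representation on the
unit square: the matrices of balanced partitions of unity are the same for both. -/
lemma exists_measure_familyMatrix {P : Type*} [MeasurableSpace P] [StandardBorelSpace P]
    (lam : Measure P) [IsProbabilityMeasure lam] (hat : ∀ p, lam {p} = 0)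
    (ν : Measure (P × P)) [IsFiniteMeasure ν] (hν : ν.map Prod.swap = ν) :
    ∃ μ : Measure (I × I), IsFiniteMeasure μ ∧ IsSymmetricMeasure μ ∧
      μ Set.univ = ν Set.univ ∧ ∀ k : ℕ, 1 ≤ k → ∀ X : Matrix (Fin k) (Fin k) ℝ,
        X ∈ measureShapeZero μ k ↔ ∃ g : Fin k → P → ℝ, IsPartition g ∧
          (∀ j, Measurable (g j)) ∧ (∀ j, ∫ p, g j p ∂lam = 1 / k) ∧
          ∀ a b, X a b = ∫ p, g a p.1 * g b p.2 ∂ν := by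
  obtain ⟨ψ, hψ, hψv, D, hD, hD0, hD1, hinj⟩ :=
    exists_map_eq_volume_injOn lam (ν.map Prod.fst) hat
  have hψψ : Measurable (Prod.map ψ ψ) := hψ.prodMap hψ
  have hvol : ∀ f : I → ℝ, Measurable f → ∫ t, f t = ∫ p, f (ψ p) ∂lam := fun f hf => by
    rw [← hψv, integral_map hψ.aemeasurable hf.aestronglyMeasurable]
  have hmul : ∀ (k : ℕ) (f : Fin k → I → ℝ), (∀ j, Measurable (f j)) → ∀ a b,
      familyMatrix (ν.map (Prod.map ψ ψ)) f a b = ∫ p, f a (ψ p.1) * f b (ψ p.2) ∂ν := by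
    intro k f hf a b
    exact integral_map hψψ.aemeasurable (((hf a).comp measurable_fst).mul
      ((hf b).comp measurable_snd)).aestronglyMeasurable
  have hν1 : ∀ᵐ p ∂ν, p.1 ∉ D :=
    ae_of_ae_map measurable_fst.aemeasurable (measure_eq_zero_iff_ae_notMem.1 hD1)
  have hν2 : ∀ᵐ p ∂ν, p.2 ∉ D := by
    have h2 : ν.map Prod.snd = ν.map Prod.fst := by
      conv_lhs => rw [← hν]
      rw [Measure.map_map measurable_snd measurable_swap]
      rfl
    exact ae_of_ae_map measurable_snd.aemeasurable
      (measure_eq_zero_iff_ae_notMem.1 (h2 ▸ hD1))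
  refine ⟨ν.map (Prod.map ψ ψ), inferInstance, ?_, ?_, fun k hk X => ⟨?_, ?_⟩⟩
  · unfold IsSymmetricMeasure
    rw [Measure.map_map measurable_swap hψψ]
    conv_rhs => rw [← hν]
    rw [Measure.map_map hψψ measurable_swap]
    rfl
  · rw [Measure.map_apply hψψ MeasurableSet.univ, Set.preimage_univ]
  · rintro ⟨f, ⟨hfm, hf0, hf1, hfi⟩, rfl⟩
    refine ⟨fun j p => f j (ψ p), ⟨fun j p => hf0 j _, fun p => hf1 _⟩,
      fun j => (hfm j).comp hψ, fun j => ?_, fun a b => hmul k f hfm a b⟩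
    rw [← hvol _ (hfm j), hfi]
  · rintro ⟨g, hg, hgm, hgi, hX⟩
    obtain ⟨h, hh, hhm, hhg⟩ := exists_partition_extend hψ hD hinj hk hg hgm
    refine ⟨h, ⟨hhm, hh.1, hh.2, fun j => ?_⟩, ?_⟩
    · rw [hvol _ (hhm j), ← hgi j]
      refine integral_congr_ae ?_
      filter_upwards [measure_eq_zero_iff_ae_notMem.1 hD0] with p hp
      exact hhg p hp j
    · ext a b
      rw [hmul k h hhm, hX]
      refine integral_congr_ae ?_
      filter_upwards [hν1, hν2] with p hp1 hp2
      simp only [hhg _ hp1, hhg _ hp2]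

/-! ### The limit measure -/

lemma balancedMatrices_nonempty {k : ℕ} (hk : 1 ≤ k) (V : Type*) [Fintype V] :
    (balancedMatrices k V).Nonempty := by
  have : (k : ℝ) ≠ 0 := by positivity
  exact ⟨fun _ _ => 1 / k, fun _ _ => by positivity,
    fun _ => by rw [Finset.sum_const, Finset.card_univ, nsmul_eq_mul, mul_one_div],
    fun _ => by simp [this]⟩

lemma matrixShape_nonempty {V : Type*} [Fintype V] (S : Matrix V V ℝ) {k : ℕ} (hk : 1 ≤ k) :
    (matrixShape S k).Nonempty :=
  (balancedMatrices_nonempty hk V).image _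

/-- The space of labels, a countable product: for each `k` and `m`, a label records a point of
the standard simplex with `k + 1` vertices. -/
abbrev LabelSpace : Type := ∀ p : ℕ × ℕ, stdSimplex ℝ (Fin (p.1 + 1))

/-- If the shapes of nonnegative symmetric matrices with bounded entry sums converge to closed
sets, these sets are the shapes of a symmetric measure on the unit square. The vertices are
labelled by the columns of countably many balanced matrices realizing dense subsets of the limit
sets. -/
lemma exists_measure_hausdorffTendsto {V : ℕ → Type*} [∀ i, Fintype (V i)] [∀ i, Nonempty (V i)]
    {S : ∀ i, Matrix (V i) (V i) ℝ} (hS : ∀ i x y, 0 ≤ S i x y) (hsymm : ∀ i, (S i).IsSymm)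
    {c : ℝ} (hc : ∀ i, entrySum (S i) ≤ c)
    (h : ∀ k, 1 ≤ k → ∃ L : Set (Matrix (Fin k) (Fin k) ℝ), IsClosed L ∧
      HausdorffTendsto (fun i => matrixShape (S i) k) L) :
    ∃ μ : Measure (I × I), IsFiniteMeasure μ ∧ IsSymmetricMeasure μ ∧
      (∀ a, (∀ i, entrySum (S i) = a) → μ.real Set.univ = a) ∧
      ∀ k, 1 ≤ k → HausdorffTendsto (fun i => matrixShape (S i) k) (measureShape μ k) := by
  have h' : ∀ k, ∃ L : Set (Matrix (Fin k) (Fin k) ℝ), 1 ≤ k → IsClosed L ∧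
      HausdorffTendsto (fun i => matrixShape (S i) k) L := fun k => by
    by_cases hk : 1 ≤ k
    · exact (h k hk).imp fun L hL _ => hL
    · exact ⟨∅, fun hk' => absurd hk' hk⟩
  choose L hLlim using h'
  have hL := fun k hk => (hLlim k hk).1
  have hlim := fun k hk => (hLlim k hk).2
  have hk1 : ∀ k : ℕ, 1 ≤ k + 1 := fun k => Nat.le_add_left 1 k
  have hdense : ∀ k : ℕ, ∃ X : ℕ → L (k + 1), DenseRange X := fun k => by
    have : Nonempty (L (k + 1)) :=
      ((hlim _ (hk1 k)).nonempty fun i => matrixShape_nonempty _ (hk1 k)).to_subtype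
    have : SecondCountableTopology (Matrix (Fin (k + 1)) (Fin (k + 1)) ℝ) :=
      inferInstanceAs (SecondCountableTopology (Fin (k + 1) → Fin (k + 1) → ℝ))
    exact TopologicalSpace.exists_dense_seq _
  choose X hX using hdense
  have hreal : ∀ p : ℕ × ℕ, ∃ M : ∀ i, Matrix (Fin (p.1 + 1)) (V i) ℝ,
      (∀ i, M i ∈ balancedMatrices (p.1 + 1) (V i)) ∧ ∀ a b,
        Tendsto (fun i => (M i * S i * (M i).transpose) a b) atTop
          (𝓝 ((X p.1 p.2 : Matrix _ _ ℝ) a b)) := fun p => by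
    obtain ⟨Y, hY, hYt⟩ := (hlim _ (hk1 p.1)).exists_tendsto
      (fun i => matrixShape_nonempty _ (hk1 p.1)) (X p.1 p.2).2
    choose M hM hMY using hY
    exact ⟨M, hM, fun a b => by simpa only [hMY] using hYt a b⟩
  choose M hM hMX using hreal
  let q : ∀ i, V i → LabelSpace := fun i x p =>
    ⟨fun j => M p i j x, fun j => (hM p i).1 j x, (hM p i).2.2 x⟩
  set U : Ultrafilter ℕ := hyperfilter ℕ with hU
  have hUle : (U : Filter ℕ) ≤ atTop := Nat.hyperfilter_le_atTop
  obtain ⟨lam, hlamf, hlam⟩ := exists_tendsto_integral U (fun i => vertexMeasure (q i))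
    (C := 1) fun i => by simp
  have hreal : ∀ i, (edgeMeasure (S i) (q i)).real Set.univ = entrySum (S i) := fun i => by
    rw [measureReal_def, edgeMeasure_univ _ (hS i)]
    exact ENNReal.toReal_ofReal
      (Finset.sum_nonneg fun x _ => Finset.sum_nonneg fun y _ => hS i x y)
  obtain ⟨ν, hνf, hν⟩ := exists_tendsto_integral U (fun i => edgeMeasure (S i) (q i))
    (C := c) fun i => (hreal i).trans_le (hc i)
  -- the interval coordinate is uniform in the limit, so the limit has no atoms
  have hsnd : lam.map Prod.snd = (volume : Measure I) := by
    refine ext_of_forall_integral_eq_of_IsFiniteMeasure fun f => ?_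
    rw [integral_map measurable_snd.aemeasurable f.continuous.measurable.aestronglyMeasurable]
    refine tendsto_nhds_unique (hlam _ (f.continuous.comp continuous_snd)) ?_
    refine tendsto_const_nhds.congr fun i => ?_
    rw [← map_snd_vertexMeasure (q i),
      integral_map measurable_snd.aemeasurable f.continuous.measurable.aestronglyMeasurable]
  have hlamp : IsProbabilityMeasure lam := by
    constructor
    have := congrArg (fun m => m Set.univ) hsnd
    simpa [Measure.map_apply measurable_snd MeasurableSet.univ] using this
  have hat : ∀ p, lam {p} = 0 := fun p => by
    refine measure_mono_null (t := Prod.snd ⁻¹' {p.2}) (by rintro _ rfl; rfl) ?_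
    rw [← Measure.map_apply measurable_snd (measurableSet_singleton _), hsnd, measure_singleton]
  have hνs : ν.map Prod.swap = ν := by
    refine ext_of_forall_integral_eq_of_IsFiniteMeasure fun f => ?_
    rw [integral_map measurable_swap.aemeasurable f.continuous.measurable.aestronglyMeasurable]
    refine tendsto_nhds_unique (hν _ (f.continuous.comp continuous_swap)) ?_
    refine (hν _ f.continuous).congr fun i => ?_
    conv_lhs => rw [← map_swap_edgeMeasure (S i) (hsymm i) (q i)]
    rw [integral_map measurable_swap.aemeasurable f.continuous.measurable.aestronglyMeasurable]
  obtain ⟨μ, hμf, hμs, hμν, hμ⟩ := exists_measure_familyMatrix lam hat ν hνs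
  refine ⟨μ, hμf, hμs, fun a ha => ?_, fun k hk => ?_⟩
  · rw [measureReal_def, hμν]
    have h1 := hν (fun _ => 1) continuous_const
    simp only [integral_const, smul_eq_mul, mul_one, hreal, ha] at h1
    exact tendsto_nhds_unique h1 tendsto_const_nhds
  · suffices heq : measureShape μ k = L k from heq ▸ hlim k hk
    refine Set.Subset.antisymm (closure_minimal (fun Y hY => ?_) (hL k hk)) ?_
    · obtain ⟨g, hg, hgm, hgi, hYg⟩ := (hμ k hk Y).1 hY
      refine (hlim k hk).mem_of_eventually_near (hL k hk) hUle fun ε hε => ?_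
      simp only [hYg]
      exact eventually_exists_matrixShape_near hS hc q hlam hν hk hg hgm hgi hε
    · obtain ⟨k, rfl⟩ := Nat.exists_eq_add_of_le' hk
      -- the coordinates of the labelling space realize the dense sequence in the limit set
      have hmem : ∀ m, (X k m : Matrix _ _ ℝ) ∈ measureShapeZero μ (k + 1) := fun m => by
        let g : Fin (k + 1) → LabelSpace × I → ℝ := fun j p => (p.1 (k, m)).1 j
        have hg : IsPartition g := ⟨fun j p => (p.1 (k, m)).2.1 j, fun p => (p.1 (k, m)).2.2⟩
        have hgc : ∀ j, Continuous (g j) := fun j => (continuous_apply j).comp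
          (continuous_subtype_val.comp ((continuous_apply (k, m)).comp continuous_fst))
        have hgm : ∀ j, Measurable (g j) := fun j => (hgc j).measurable
        have hMi : ∀ i j x, M (k, m) i j x = ∫ t : I, g j (q i x, t) := fun i j x => by
          simp [g, q]
        refine (hμ _ hk _).2 ⟨g, hg, hgm, fun j => ?_, fun a b => ?_⟩
        · refine tendsto_nhds_unique (hlam _ (hgc j)) (tendsto_const_nhds.congr fun i => ?_)
          have hn : (Fintype.card (V i) : ℝ) ≠ 0 := by exact_mod_cast Fintype.card_ne_zero
          rw [integral_vertexMeasure hg hgm]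
          simp only [← hMi]
          rw [(hM (k, m) i).2.1 j]
          field_simp
        · refine tendsto_nhds_unique ((hMX (k, m) a b).mono_left hUle)
            ((hν _ (((hgc a).comp continuous_fst).mul ((hgc b).comp continuous_snd))).congr
              fun i => ?_)
          exact integral_edgeMeasure hg hgm (hS i) (q i) a b (hMi i)
      intro Y hY
      refine closure_mono ?_ (closure_subtype.1 (hX k ⟨Y, hY⟩))
      rintro _ ⟨_, ⟨m, rfl⟩, rfl⟩
      exact hmem m

/-! ### Reduction of graphs and empty matrices -/

lemma matrixShape_smul {V : Type*} [Fintype V] (S : Matrix V V ℝ) (r : ℝ) (k : ℕ) :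
    matrixShape (r • S) k = (fun X => r • X) '' matrixShape S k := by
  unfold matrixShape
  rw [Set.image_image]
  simp only [Matrix.mul_smul, Matrix.smul_mul]

lemma matrixShape_of_isEmpty {V : Type*} [Fintype V] [IsEmpty V] (S : Matrix V V ℝ) {k : ℕ}
    (hk : 1 ≤ k) : matrixShape S k = {0} := by
  refine Set.Subset.antisymm ?_ ?_
  · rintro _ ⟨M, -, rfl⟩
    ext a b
    simp [mul_mul_transpose_apply]
  · obtain ⟨X, M, hM, rfl⟩ := matrixShape_nonempty S hk
    rintro _ rfl
    refine ⟨M, hM, ?_⟩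
    ext a b
    simp [mul_mul_transpose_apply]

lemma matrixShape_zero (V : Type*) [Fintype V] {k : ℕ} (hk : 1 ≤ k) :
    matrixShape (0 : Matrix V V ℝ) k = {0} := by
  refine Set.Subset.antisymm ?_ ?_
  · rintro _ ⟨M, -, rfl⟩
    simp
  · obtain ⟨M, hM⟩ := balancedMatrices_nonempty hk V
    rintro _ rfl
    exact ⟨M, hM, by simp⟩

/-- A matrix with an empty index set has the same shapes as the zero matrix of size `1`. -/
lemma exists_nonempty_matrixShape_eq.{u} {V : Type u} [Fintype V] (S : Matrix V V ℝ)
    (hS : ∀ x y, 0 ≤ S x y) (hsymm : S.IsSymm) :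
    ∃ (W : Type u) (_ : Fintype W) (_ : Nonempty W) (T : Matrix W W ℝ),
      (∀ x y, 0 ≤ T x y) ∧ T.IsSymm ∧ entrySum T = entrySum S ∧
        ∀ k, 1 ≤ k → matrixShape T k = matrixShape S k := by
  rcases isEmpty_or_nonempty V with hV | hV
  · refine ⟨PUnit, inferInstance, inferInstance, 0, fun _ _ => le_rfl, Matrix.transpose_zero,
      by simp [entrySum], fun k hk => ?_⟩
    rw [matrixShape_zero _ hk, matrixShape_of_isEmpty _ hk]
  · exact ⟨V, inferInstance, hV, S, hS, hsymm, rfl, fun _ _ => rfl⟩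

lemma LoopGraph.adjMatrix_nonneg {V : Type*} (G : LoopGraph V) (x y : V) :
    0 ≤ G.adjMatrix x y := by
  unfold LoopGraph.adjMatrix
  split_ifs <;> norm_num

lemma LoopGraph.l1Norm_adjMatrix {V : Type*} [Fintype V] (G : LoopGraph V) :
    l1Norm G.adjMatrix = entrySum G.adjMatrix := by
  simp only [l1Norm, entrySum, abs_of_nonneg (G.adjMatrix_nonneg _ _)]

lemma LoopGraph.l1Norm_adjMatrix_pos {V : Type*} [Fintype V] (G : LoopGraph V)
    (h : ∃ x y, G.Adj x y) : 0 < l1Norm G.adjMatrix := by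
  obtain ⟨x, y, hxy⟩ := h
  have h1 : 0 < |G.adjMatrix x y| := by simp [LoopGraph.adjMatrix, hxy]
  refine Finset.sum_pos' (fun x _ => Finset.sum_nonneg fun y _ => abs_nonneg _)
    ⟨x, Finset.mem_univ x, Finset.sum_pos' (fun y _ => abs_nonneg _) ⟨y, Finset.mem_univ y, h1⟩⟩

lemma LoopGraph.isSymm_adjMatrix {V : Type*} (G : LoopGraph V) : G.adjMatrix.IsSymm := by
  ext x y
  have : G.Adj y x ↔ G.Adj x y := ⟨G.symm y x, G.symm x y⟩
  by_cases hxy : G.Adj x y <;> simp [LoopGraph.adjMatrix, this, hxy]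

lemma entrySum_smul {V : Type*} [Fintype V] (r : ℝ) (S : Matrix V V ℝ) :
    entrySum (r • S) = r * entrySum S := by
  simp [entrySum, Finset.mul_sum]

end ShapeLimit

end

theorem mainTheorem2 :
    (∀ (V : ℕ → Type*) [∀ i, Fintype (V i)] (G : ∀ i, ShapeLimit.LoopGraph (V i)),
      (∀ i, ∃ x y, (G i).Adj x y) →
      ShapeLimit.SConvergent G →
      ∃ μ : MeasureTheory.Measure (unitInterval × unitInterval),
        ShapeLimit.IsSGraphon μ ∧
        ∀ k : ℕ, 1 ≤ k →
          ShapeLimit.HausdorffTendsto (fun i => ShapeLimit.graphShape (G i) k)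
            (ShapeLimit.measureShape μ k)) ∧
    (∀ (V : ℕ → Type*) [∀ i, Fintype (V i)] (S : ∀ i, Matrix (V i) (V i) ℝ),
      (∀ i x y, 0 ≤ S i x y) →
      (∀ i, (S i).IsSymm) →
      ShapeLimit.MatrixSeqConvergent S →
      ∃ μ : MeasureTheory.Measure (unitInterval × unitInterval),
        MeasureTheory.IsFiniteMeasure μ ∧ ShapeLimit.IsSymmetricMeasure μ ∧
        ∀ k : ℕ, 1 ≤ k →
          ShapeLimit.HausdorffTendsto (fun i => ShapeLimit.matrixShape (S i) k)
            (ShapeLimit.measureShape μ k)) := by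
  constructor
  · intro V _ G hG hconv
    have hne : ∀ i, Nonempty (V i) := fun i => ⟨(hG i).choose⟩
    have hpos := fun i => (G i).l1Norm_adjMatrix_pos (hG i)
    have hshape : ∀ k i, ShapeLimit.graphShape (G i) k = ShapeLimit.matrixShape
        ((ShapeLimit.l1Norm (G i).adjMatrix)⁻¹ • (G i).adjMatrix) k :=
      fun k i => (ShapeLimit.matrixShape_smul _ _ k).symm
    have hsum : ∀ i, ShapeLimit.entrySum
        ((ShapeLimit.l1Norm (G i).adjMatrix)⁻¹ • (G i).adjMatrix) = 1 := fun i => by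
      rw [ShapeLimit.entrySum_smul, ← (G i).l1Norm_adjMatrix, inv_mul_cancel₀ (hpos i).ne']
    unfold ShapeLimit.SConvergent at hconv
    simp only [hshape] at hconv ⊢
    obtain ⟨μ, -, hμs, hμ1, hμ⟩ := ShapeLimit.exists_measure_hausdorffTendsto
      (S := fun i => (ShapeLimit.l1Norm (G i).adjMatrix)⁻¹ • (G i).adjMatrix)
      (fun i x y => mul_nonneg (inv_nonneg.2 (hpos i).le) ((G i).adjMatrix_nonneg x y))
      (fun i => (G i).isSymm_adjMatrix.smul _) (fun i => (hsum i).le) hconv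
    refine ⟨μ, ⟨⟨?_⟩, hμs⟩, hμ⟩
    have := hμ1 1 hsum
    rwa [MeasureTheory.measureReal_def, ENNReal.toReal_eq_one_iff] at this
  · intro V _ S hS hsymm hconv
    obtain ⟨c, -, hc, hconv⟩ := hconv
    choose W hWf hWn T hT hTs hTe hTk using fun i =>
      ShapeLimit.exists_nonempty_matrixShape_eq (S i) (hS i) (hsymm i)
    obtain ⟨μ, hμf, hμs, -, hμ⟩ := ShapeLimit.exists_measure_hausdorffTendsto hT hTs
      (fun i => (hTe i).trans_le (hc i).le) fun k hk => by
        obtain ⟨L, hL, -, hlim⟩ := hconv k hk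
        exact ⟨L, hL, by simpa only [hTk _ k hk] using hlim⟩
    exact ⟨μ, hμf, hμs, fun k hk => by simpa only [hTk _ k hk] using hμ k hk⟩
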